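/- **Definitions.** For metric spaces $M,N$, the distortion $c_M(N)\in[0,\infty]$ is the infimum of those $D>0$ for which there are $r>0$ and $f:N\to M$ with $r\,d_N(x,y)\le d_M(f(x),f(y))\le D\,r\,d_N(x,y)$ for all $x,y\in N$ (and $c_M(N)=\infty$ if there is no such $D$). $B_n$ is the complete unweighted binary tree of depth $n$ with its shortest-path metric. A metric space is doubling if there is $K\in\mathbb N$ such that every ball of radius $r>0$ is covered by at most $K$ balls of radius $r/2$. For a (discrete, possibly time-inhomogeneous) Markov chain $(X_t)_{t\in\mathbb Z}$ on a set $\Omega$ and $s\in\mathbb Z$, let $(\widetilde X_t(s))_{t\in\mathbb Z}$ be the process that equals $X_t$ for $t\le s$ and evolves independently of $X$, with the same transition probabilities, for $t>s$. For $p>0$, a metric space $(X,d)$ is Markov $p$-convex if there is a finite constant $\Pi$ such that for every Markov chain $(X_t)_{t\in\mathbb Z}$ on any $\Omega$ and every $f:\Omega\to X$, $$\sum_{k=0}^{\infty}\sum_{t\in\mathbb Z}\frac{\mathbb E\big[d\big(f(X_t),f(\widetilde X_t(t-2^k))\big)^p\big]}{2^{kp}}\le \Pi^p\sum_{t\in\mathbb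 Z}\mathbb E\big[d(f(X_t),f(X_{t-1}))^p\big].$$ **Theorem.** There is a doubling metric space $(X,d)$ that is not Markov $p$-convex for any $p\in(0,\infty)$, and yet $\lim_{n\to\infty}c_X(B_n)=\infty$; in fact, there is a constant $\kappa>0$ such that $c_X(B_n)\ge 2^{\kappa n}$ for all sufficiently large $n$. -/

import Mathlib

open scoped ENNReal NNReal Topology
open Filter

noncomputable section

/-! ### Binary trees -/

/-- Vertices of the complete binary tree of depth `n`: binary words of length at most `n`
(the empty word is the root, and `b :: v` are the two children of `v`). -/
def CompleteBinaryTree (n : ℕ) : Type := {l : List Bool // l.length ≤ n}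

/-- The complete unweighted binary tree of depth `n`: each word `v` of length less than `n` is
joined to its two children `false :: v` and `true :: v`. -/
def binaryTreeGraph (n : ℕ) : SimpleGraph (CompleteBinaryTree n) where
  Adj u v := (∃ b : Bool, v.1 = b :: u.1) ∨ (∃ b : Bool, u.1 = b :: v.1)
  symm := ⟨fun _ _ h => h.symm⟩
  loopless := ⟨by
    rintro ⟨u, hu⟩ (⟨b, h⟩ | ⟨b, h⟩) <;> simp at h⟩

theorem binaryTreeGraph_connected (n : ℕ) : (binaryTreeGraph n).Connected := by
  have key : ∀ (l : List Bool) (h : l.length ≤ n),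
      (binaryTreeGraph n).Reachable ⟨[], Nat.zero_le n⟩ ⟨l, h⟩ := by
    intro l
    induction l with
    | nil => intro h; exact SimpleGraph.Reachable.refl _
    | cons b l ih =>
      intro h
      have hl : l.length ≤ n := by simp at h; omega
      refine (ih hl).trans (SimpleGraph.Adj.reachable ?_)
      exact Or.inl ⟨b, rfl⟩
  exact
    { preconnected := fun u v => (key u.1 u.2).symm.trans (key v.1 v.2)
      nonempty := ⟨⟨[], Nat.zero_le n⟩⟩ }

/-- The shortest-path metric on the complete binary tree of depth `n`. -/
instance (n : ℕ) : MetricSpace (CompleteBinaryTree n) where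
  dist u v := ((binaryTreeGraph n).dist u v : ℝ)
  dist_self u := by simp
  dist_comm u v := by rw [SimpleGraph.dist_comm]
  dist_triangle u v w := by exact_mod_cast (binaryTreeGraph_connected n).dist_triangle
  eq_of_dist_eq_zero {u v} h := by
    have h0 : (binaryTreeGraph n).dist u v = 0 := by exact_mod_cast h
    exact (binaryTreeGraph_connected n).dist_eq_zero_iff.mp h0

/-! ### Bi-Lipschitz distortion -/

/-- `N` embeds into `M` with distortion at most `D`, after rescaling by some `r > 0`. -/
def EmbedsWithDistortion (M N : Type*) [MetricSpace M] [MetricSpace N] (D : ℝ) : Prop :=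
  ∃ r : ℝ, 0 < r ∧ ∃ f : N → M, ∀ x y : N,
    r * dist x y ≤ dist (f x) (f y) ∧ dist (f x) (f y) ≤ D * r * dist x y

/-- The distortion `c_M(N)` : the infimum of those `D > 0` such that `N` embeds into `M` with
distortion at most `D`. It is `∞` if there is no such `D`. -/
def distortion (M N : Type*) [MetricSpace M] [MetricSpace N] : ℝ≥0∞ :=
  ⨅ (D : ℝ) (_ : 0 < D ∧ EmbedsWithDistortion M N D), ENNReal.ofReal D

/-! ### Doubling metric spaces -/

/-- A metric space is doubling if, for some `K`, every ball is covered by at most `K` balls of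
half its radius. -/
def IsDoublingSpace (X : Type*) [MetricSpace X] : Prop :=
  ∃ K : ℕ, ∀ (x : X) (r : ℝ), 0 < r → ∃ S : Finset X,
    S.card ≤ K ∧ Metric.ball x r ⊆ ⋃ y ∈ S, Metric.ball y (r / 2)

/-! ### Markov convexity -/

/-- The data of a discrete Markov chain `(X_t)`, `t ∈ ℤ`, with state space the set `Ω`: the law of
each `X_t`, and the (possibly time-dependent) transition probabilities from `X_t` to `X_{t+1}`. -/
structure MarkovChain (Ω : Type*) where
  /-- The law of `X_t`. -/
  law : ℤ → PMF Ω
  /-- `step t x` is the law of `X_{t+1}` conditionally on `X_t = x` and on the past. -/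
  step : ℤ → Ω → PMF Ω
  law_succ : ∀ t : ℤ, law (t + 1) = (law t).bind (step t)

namespace MarkovChain

variable {Ω : Type*} (c : MarkovChain Ω)

/-- The joint law of `(X_t, X_{t+1})`. -/
def consecutiveLaw (t : ℤ) : PMF (Ω × Ω) :=
  (c.law t).bind fun x => (c.step t x).map fun y => (x, y)

/-- The joint law of the pair `(X_{s+n}, X'_{s+n})`, where `X'` equals `X` for all times `≤ s`, and
evolves independently of `X`, with the same transition probabilities, for times `> s`. -/
def branchedLaw (s : ℤ) : ℕ → PMF (Ω × Ω)
  | 0 => (c.law s).map fun x => (x, x)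
  | n + 1 => (branchedLaw s n).bind fun q =>
      (c.step (s + n) q.1).bind fun x => (c.step (s + n) q.2).map fun y => (x, y)

end MarkovChain

/-- The expectation of `d(f(Y), f(Z))^p`, where `(Y, Z)` has law `π`. -/
def expectDistPow {Ω X : Type*} [MetricSpace X] (π : PMF (Ω × Ω)) (f : Ω → X) (p : ℝ) : ℝ≥0∞ :=
  ∑' q : Ω × Ω, π q * edist (f q.1) (f q.2) ^ p

/-- `X` is Markov `p`-convex with constant `C`. In the left-hand side, the time at which the second
copy of the chain branches off is `t - 2 ^ k`, i.e. `2 ^ k` steps before time `t`. -/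
def IsMarkovConvexWith (X : Type*) [MetricSpace X] (p : ℝ) (C : ℝ≥0) : Prop :=
  ∀ (Ω : Type) (c : MarkovChain Ω) (f : Ω → X),
    ∑' k : ℕ, ∑' t : ℤ,
        expectDistPow (c.branchedLaw (t - 2 ^ k) (2 ^ k)) f p / (2 : ℝ≥0∞) ^ ((k : ℝ) * p)
      ≤ (C : ℝ≥0∞) ^ p * ∑' t : ℤ, expectDistPow (c.consecutiveLaw (t - 1)) f p

/-- `X` is Markov `p`-convex, i.e. its Markov `p`-convexity constant is finite. -/
def IsMarkovConvex (X : Type*) [MetricSpace X] (p : ℝ) : Prop :=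
  ∃ C : ℝ≥0, IsMarkovConvexWith X p C

end

/-!
The space is a Laakso-type space: above the middle half of every interval of length `4 ^ (k + 2)`
of the real line, for every `k : ℕ`, there are two sheets, which join at the ends of the middle
half. It is realized inside `ℓ^∞` (`laaksoSet`): coordinate `0` is the height `t`, and coordinate
`k + 1` is `± middleDist k t`, where `middleDist k t` is the distance from `t` to the complement of
the middle halves of scale `k`. The ambient metric then takes the place of the geodesic metric of
the Laakso graphs.

It is doubling (`isDoublingSpace_laaksoSet`) because a ball of radius `r` meets both sheets of at
most one scale that is large compared with `r` (`MeetsBothSheets.quarter_lt`): the ends of a middle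
half are ends of intervals of all smaller scales, near which those scales have only one sheet. So a
rough height, the signs at that scale, and the signs at boundedly many scales comparable with `r`
determine a point of the ball up to `r / 4`.

In a doubling space, a ball holds only polynomially many separated points in terms of the ratio of
its radius to their separation, while a binary tree has `2 ^ n` leaves within distance `n` of its
root; this makes the distortion of the tree exponential in `n`
(`IsDoublingSpace.exists_rpow_le_distortion`).

The chain that defeats Markov convexity climbs from height `0` to height `4 ^ (M + 2)` at unit
speed, and picks one of the two sheets by a fair coin whenever it enters a middle half. Consecutive
positions are at distance at most `1`. For a fixed proportion of the times `t`, a copy that branched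
off `2 ^ (2 * k + 2)` steps before `t` is on the other sheet of scale `k` with probability `1 / 2`,
and then at distance at least `2 ^ (2 * k + 2)` (`half_le_expectDistPow_branchedLaw`). So each of the
scales `k < M` contributes at least a fixed fraction of `4 ^ (M + 2)` to the left-hand side of the Markov
convexity inequality, whatever `p` is, and the inequality fails for large `M`.
-/

noncomputable section

/-! ### A Laakso-type space in `ℓ^∞` -/

/-- The distance from `t` to the complement of the open middle halves of the intervals
`[4 ^ (k + 2) * n, 4 ^ (k + 2) * (n + 1)]`, `n ∈ ℤ`. -/
def middleDist (k : ℕ) (t : ℝ) : ℝ :=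
  max 0 (|t - 4 ^ (k + 2) * round (t / 4 ^ (k + 2))| - 4 ^ (k + 1))

theorem abs_sub_mul_round_div_le {P : ℝ} (hP : 0 < P) (t : ℝ) (n : ℤ) :
    |t - P * round (t / P)| ≤ |t - P * n| := by
  have h : ∀ z : ℝ, |t - P * z| = P * |t / P - z| := fun z => by
    rw [← abs_of_pos hP, ← abs_mul, abs_of_pos hP, mul_sub, mul_div_cancel₀ _ hP.ne']
  rw [h, h]
  exact mul_le_mul_of_nonneg_left (round_le _ _) hP.le

theorem middleDist_nonneg (k : ℕ) (t : ℝ) : 0 ≤ middleDist k t := le_max_left _ _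

theorem middleDist_le_quarter (k : ℕ) (t : ℝ) : middleDist k t ≤ 4 ^ (k + 1) := by
  have hP : (0 : ℝ) < 4 ^ (k + 2) := by positivity
  have h1 := abs_sub_round (t / 4 ^ (k + 2))
  have h2 : |t - 4 ^ (k + 2) * round (t / 4 ^ (k + 2))| ≤ 4 ^ (k + 2) * (1 / 2) := by
    calc |t - 4 ^ (k + 2) * round (t / 4 ^ (k + 2))|
        = 4 ^ (k + 2) * |t / 4 ^ (k + 2) - round (t / 4 ^ (k + 2))| := by
          rw [← abs_of_pos hP, ← abs_mul, abs_of_pos hP, mul_sub, mul_div_cancel₀ _ hP.ne']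
      _ ≤ _ := mul_le_mul_of_nonneg_left h1 hP.le
  have h3 : (4 : ℝ) ^ (k + 2) = 4 * 4 ^ (k + 1) := by ring
  refine max_le (by positivity) ?_
  linarith

theorem middleDist_le_add (k : ℕ) (s t : ℝ) : middleDist k t ≤ middleDist k s + |t - s| := by
  have h1 := abs_sub_mul_round_div_le (P := 4 ^ (k + 2)) (by positivity) t
    (round (s / 4 ^ (k + 2)))
  have h2 := abs_sub_le t s (4 ^ (k + 2) * round (s / 4 ^ (k + 2)))
  have h3 : |s - 4 ^ (k + 2) * round (s / 4 ^ (k + 2))| - 4 ^ (k + 1) ≤ middleDist k s :=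
    le_max_right _ _
  have h4 := middleDist_nonneg k s
  refine max_le (by positivity) ?_
  linarith

theorem abs_middleDist_sub_le (k : ℕ) (s t : ℝ) :
    |middleDist k s - middleDist k t| ≤ |s - t| := by
  have h1 := middleDist_le_add k s t
  have h2 := middleDist_le_add k t s
  rw [abs_sub_comm t s] at h1
  exact abs_sub_le_iff.2 ⟨by linarith, by linarith⟩

theorem middleDist_le_abs (k : ℕ) (t : ℝ) : middleDist k t ≤ |t| := by
  have h1 := abs_sub_mul_round_div_le (P := 4 ^ (k + 2)) (by positivity) t 0
  have h2 : (0 : ℝ) < 4 ^ (k + 1) := by positivity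
  refine max_le (abs_nonneg t) ?_
  simp only [Int.cast_zero, mul_zero, sub_zero] at h1
  linarith

theorem lt_abs_sub_of_middleDist_pos {k : ℕ} {t : ℝ} (h : 0 < middleDist k t) (n : ℤ) :
    4 ^ (k + 1) < |t - 4 ^ (k + 2) * n| := by
  have h1 := abs_sub_mul_round_div_le (P := 4 ^ (k + 2)) (by positivity) t n
  rcases lt_max_iff.1 h with h2 | h2
  · exact absurd h2 (lt_irrefl _)
  · linarith

theorem exists_abs_sub_eq_middleDist {k : ℕ} {t : ℝ} (h : 0 < middleDist k t) :
    ∃ n : ℤ, |t - 4 ^ (k + 1) * n| = middleDist k t := by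
  have h1 : |t - 4 ^ (k + 2) * round (t / 4 ^ (k + 2))| - 4 ^ (k + 1) = middleDist k t := by
    rcases max_choice 0 (|t - 4 ^ (k + 2) * round (t / 4 ^ (k + 2))| - 4 ^ (k + 1)) with h2 | h2
    · exact absurd h2 h.ne'
    · exact h2.symm
  have h3 : (4 : ℝ) ^ (k + 2) = 4 * 4 ^ (k + 1) := by ring
  rcases le_total 0 (t - 4 ^ (k + 2) * round (t / 4 ^ (k + 2))) with h0 | h0
  · refine ⟨4 * round (t / 4 ^ (k + 2)) + 1, ?_⟩
    rw [abs_of_nonneg h0] at h1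
    push_cast
    rw [← abs_of_nonneg h.le, ← h1, h3]
    ring_nf
  · refine ⟨4 * round (t / 4 ^ (k + 2)) - 1, ?_⟩
    rw [abs_of_nonpos h0] at h1
    push_cast
    rw [← abs_of_nonneg h.le, ← h1, h3, ← abs_neg]
    ring_nf

/-- A Laakso-type space, as a subset of `ℓ^∞`. Coordinate `0` of a point is its height `t ∈ ℝ`.
Above the middle half of each interval `[4 ^ (k + 2) * n, 4 ^ (k + 2) * (n + 1)]` the space has two
sheets, told apart by the sign of coordinate `k + 1`, which open up linearly in the distance from
the ends of the middle half. -/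
def laaksoSet : Set (BoundedContinuousFunction ℕ ℝ) :=
  {v | ∀ k, |v (k + 1)| = middleDist k (v 0)}

/-- The height `t` together with a sign for each scale determines a point of `laaksoSet`. -/
def laaksoPoint (t : ℝ) (ε : ℕ → Bool) : laaksoSet :=
  ⟨BoundedContinuousFunction.ofNormedAddCommGroupDiscrete
    (fun i => i.casesOn t fun k => if ε k then middleDist k t else -middleDist k t) |t| (by
      rintro (_ | k)
      · exact le_rfl
      · have h1 := middleDist_nonneg k t
        have h2 := middleDist_le_abs k t
        change ‖if ε k then middleDist k t else -middleDist k t‖ ≤ |t|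
        split_ifs <;> simpa [abs_of_nonneg h1] using h2), by
    intro k
    change |if ε k then middleDist k t else -middleDist k t| = middleDist k t
    have h1 := middleDist_nonneg k t
    split_ifs <;> simp [abs_of_nonneg h1]⟩

theorem laaksoPoint_succ (t : ℝ) (ε : ℕ → Bool) (k : ℕ) :
    (laaksoPoint t ε).1 (k + 1) = if ε k then middleDist k t else -middleDist k t := rfl

theorem abs_sub_le_dist_laaksoSet (v w : laaksoSet) (i : ℕ) : |v.1 i - w.1 i| ≤ dist v w :=
  BoundedContinuousFunction.dist_coe_le_dist (f := v.1) (g := w.1) i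

theorem abs_sub_eq_abs_abs_sub_abs {a b : ℝ} (h1 : ¬(0 < a ∧ b < 0)) (h2 : ¬(0 < b ∧ a < 0)) :
    |a - b| = |(|a| - |b|)| := by
  rcases lt_trichotomy a 0 with ha | ha | ha <;> rcases lt_trichotomy b 0 with hb | hb | hb
  · rw [abs_of_neg ha, abs_of_neg hb, ← abs_neg]; ring_nf
  · simp [hb]
  · exact absurd ⟨hb, ha⟩ h2
  · simp [ha]
  · simp [ha, hb]
  · simp [ha]
  · exact absurd ⟨ha, hb⟩ h1
  · simp [hb]
  · rw [abs_of_pos ha, abs_of_pos hb]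

/-! ### The doubling property -/

theorem exists_cover_of_coloring {X α : Type*} [MetricSpace X] {x : X} {r : ℝ} (color : X → α)
    (T : Finset α) (hT : ∀ y ∈ Metric.ball x r, color y ∈ T)
    (h : ∀ y ∈ Metric.ball x r, ∀ z ∈ Metric.ball x r, color y = color z → dist y z < r / 2) :
    ∃ S : Finset X, S.card ≤ T.card ∧ Metric.ball x r ⊆ ⋃ y ∈ S, Metric.ball y (r / 2) := by
  classical
  have hrep : ∀ a : α, ∃ z : X, ∀ y ∈ Metric.ball x r, color y = a → dist y z < r / 2 := by
    intro a
    by_cases ha : ∃ z ∈ Metric.ball x r, color z = a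
    · obtain ⟨z, hz, rfl⟩ := ha
      exact ⟨z, fun y hy hyz => h y hy z hz hyz⟩
    · exact ⟨x, fun y hy hya => absurd ⟨y, hy, hya⟩ ha⟩
  choose rep hrep using hrep
  refine ⟨T.image rep, Finset.card_image_le, fun y hy => ?_⟩
  exact Set.mem_iUnion₂.2
    ⟨rep (color y), Finset.mem_image_of_mem _ (hT y hy), hrep _ y hy rfl⟩

/-- The ball of radius `r` about `x` meets both sheets of scale `k`. -/
def MeetsBothSheets (x : laaksoSet) (r : ℝ) (k : ℕ) : Prop :=
  ∃ v ∈ Metric.ball x r, ∃ w ∈ Metric.ball x r, 0 < v.1 (k + 1) ∧ w.1 (k + 1) < 0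

/-- A ball that meets both sheets of a scale `l` is near an end of a middle half of scale `l`.
This is an end of an interval of every smaller scale `k`, and near it there is only one sheet of
scale `k`, unless the ball is large at scale `k`. -/
theorem MeetsBothSheets.quarter_lt {x : laaksoSet} {r : ℝ} {k l : ℕ} (hk : MeetsBothSheets x r k)
    (hl : MeetsBothSheets x r l) (hkl : k < l) : (4 : ℝ) ^ (k + 1) < 3 * r := by
  obtain ⟨u, hu, -, -, hu0, -⟩ := hk
  obtain ⟨z, hz, hz0, hzr⟩ : ∃ z ∈ Metric.ball x r, 0 < |z.1 (l + 1)| ∧ |z.1 (l + 1)| < r := by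
    obtain ⟨v, hv, w, hw, hv0, hw0⟩ := hl
    have h1 := abs_sub_le_dist_laaksoSet v w (l + 1)
    have h2 := dist_triangle_right v w x
    rw [Metric.mem_ball] at hv hw
    rw [abs_of_pos (by linarith)] at h1
    rcases lt_or_ge (v.1 (l + 1)) r with h | h
    · exact ⟨v, hv, abs_pos.2 hv0.ne', by rwa [abs_of_pos hv0]⟩
    · exact ⟨w, hw, abs_pos.2 hw0.ne, by rw [abs_of_neg hw0]; linarith⟩
  rw [z.2 l] at hz0 hzr
  have hupos : 0 < middleDist k (u.1 0) := by rw [← u.2 k]; exact abs_pos.2 hu0.ne'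
  obtain ⟨n, hn⟩ := exists_abs_sub_eq_middleDist hz0
  have h1 := lt_abs_sub_of_middleDist_pos hupos (4 ^ (l - k - 1) * n)
  have h2 : (4 : ℝ) ^ (k + 2) * ((4 ^ (l - k - 1) * n : ℤ) : ℝ) = 4 ^ (l + 1) * n := by
    push_cast
    rw [← mul_assoc, ← pow_add]
    congr 2
    omega
  rw [h2] at h1
  have h3 := abs_sub_le_dist_laaksoSet u z 0
  have h4 := dist_triangle_right u z x
  rw [Metric.mem_ball] at hu hz
  have h5 := abs_sub_le (u.1 0) (z.1 0) (4 ^ (l + 1) * n)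
  linarith

theorem abs_sub_le_of_not_meetsBothSheets {x : laaksoSet} {r : ℝ} {k : ℕ}
    (hk : ¬MeetsBothSheets x r k) {v w : laaksoSet} (hv : v ∈ Metric.ball x r)
    (hw : w ∈ Metric.ball x r) : |v.1 (k + 1) - w.1 (k + 1)| ≤ |v.1 0 - w.1 0| := by
  rw [abs_sub_eq_abs_abs_sub_abs (fun h => hk ⟨v, hv, w, hw, h⟩) (fun h => hk ⟨w, hw, v, hv, h⟩),
    v.2 k, w.2 k]
  exact abs_middleDist_sub_le k _ _

theorem abs_sub_le_of_pos_iff_pos {k : ℕ} {v w : laaksoSet}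
    (h : 0 < v.1 (k + 1) ↔ 0 < w.1 (k + 1)) :
    |v.1 (k + 1) - w.1 (k + 1)| ≤ |v.1 0 - w.1 0| := by
  rw [abs_sub_eq_abs_abs_sub_abs (fun h' => (h.1 h'.1).not_gt h'.2)
    (fun h' => (h.2 h'.1).not_gt h'.2), v.2 k, w.2 k]
  exact abs_middleDist_sub_le k _ _

theorem isDoublingSpace_laaksoSet : IsDoublingSpace laaksoSet := by
  refine ⟨(Finset.Icc (-4 : ℤ) 4 ×ˢ (Finset.univ : Finset (Fin 4 → Bool))).card, fun x r hr => ?_⟩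
  -- Scales below `a` are negligible at radius `r`; scales from `a + 3` on are large.
  obtain ⟨a, ha, hbelow⟩ : ∃ a : ℕ, r / 8 < 4 ^ (a + 1) ∧
      ∀ k < a, (4 : ℝ) ^ (k + 1) ≤ r / 8 := by
    have hex : ∃ a : ℕ, r / 8 < (4 : ℝ) ^ (a + 1) := by
      obtain ⟨a, ha⟩ := pow_unbounded_of_one_lt (r / 8) (show (1 : ℝ) < 4 by norm_num)
      exact ⟨a, ha.trans_le (pow_le_pow_right₀ (by norm_num) (Nat.le_succ a))⟩
    classical
    exact ⟨Nat.find hex, Nat.find_spec hex, fun k hk => not_lt.1 (Nat.find_min hex hk)⟩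
  have hlarge : ∀ k, a + 3 ≤ k → 3 * r ≤ (4 : ℝ) ^ (k + 1) := by
    intro k hk
    have h1 : (4 : ℝ) ^ (a + 1 + 3) ≤ 4 ^ (k + 1) := pow_le_pow_right₀ (by norm_num) (by omega)
    rw [pow_add] at h1
    linarith
  -- At most one large scale `b` has both sheets within the ball.
  obtain ⟨b, hb⟩ : ∃ b : ℕ, ∀ k, a + 3 ≤ k → MeetsBothSheets x r k → k = b := by
    by_cases h : ∃ b, a + 3 ≤ b ∧ MeetsBothSheets x r b
    · obtain ⟨b, hab, hb⟩ := h
      refine ⟨b, fun k hak hk => ?_⟩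
      rcases lt_trichotomy k b with hlt | heq | hlt
      · exact absurd (hk.quarter_lt hb hlt) (hlarge k hak).not_gt
      · exact heq
      · exact absurd (hb.quarter_lt hk hlt) (hlarge b hab).not_gt
    · exact ⟨0, fun k hak hk => absurd ⟨k, hak, hk⟩ h⟩
  refine exists_cover_of_coloring
    (fun v : laaksoSet => (⌊4 * (v.1 0 - x.1 0) / r⌋,
      fun i : Fin 4 => decide (0 < v.1 ((![a, a + 1, a + 2, b] i) + 1)))) _ ?_ ?_
  · intro v hv
    have h1 := (abs_sub_le_dist_laaksoSet v x 0).trans_lt (Metric.mem_ball.1 hv)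
    rw [abs_lt] at h1
    refine Finset.mem_product.2 ⟨Finset.mem_Icc.2 ⟨?_, ?_⟩, Finset.mem_univ _⟩
    · rw [Int.le_floor, le_div_iff₀ hr]
      push_cast
      linarith
    · refine Int.lt_add_one_iff.1 (Int.floor_lt.2 ?_)
      rw [div_lt_iff₀ hr]
      push_cast
      linarith
  · intro v hv w hw hvw
    rw [Prod.mk.injEq] at hvw
    have hsign : ∀ i : Fin 4, 0 < v.1 ((![a, a + 1, a + 2, b] i) + 1) ↔
        0 < w.1 ((![a, a + 1, a + 2, b] i) + 1) := fun i => by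
      simpa using congrFun hvw.2 i
    have h0 : |v.1 0 - w.1 0| ≤ r / 4 := by
      have h1 := Int.abs_sub_lt_one_of_floor_eq_floor hvw.1
      rw [← sub_div, abs_div, abs_of_pos hr, div_lt_one hr,
        show 4 * (v.1 0 - x.1 0) - 4 * (w.1 0 - x.1 0) = 4 * (v.1 0 - w.1 0) by ring, abs_mul,
        abs_of_pos (by norm_num : (0 : ℝ) < 4)] at h1
      linarith
    have hle : dist v w ≤ r / 4 := by
      refine (BoundedContinuousFunction.dist_le (f := v.1) (g := w.1) (by positivity)).2 ?_
      rintro (_ | k)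
      · exact h0
      · change |v.1 (k + 1) - w.1 (k + 1)| ≤ r / 4
        rcases lt_or_ge k a with hka | hka
        · have h1 := abs_sub (v.1 (k + 1)) (w.1 (k + 1))
          rw [v.2 k, w.2 k] at h1
          have h2 := middleDist_le_quarter k (v.1 0)
          have h3 := middleDist_le_quarter k (w.1 0)
          have h4 := hbelow k hka
          linarith
        · refine le_trans ?_ h0
          by_cases hk : MeetsBothSheets x r k
          · have hcases : k = a ∨ k = a + 1 ∨ k = a + 2 ∨ k = b := by
              rcases lt_or_ge k (a + 3) with h | h
              · omega
              · exact Or.inr (Or.inr (Or.inr (hb k h hk)))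
            rcases hcases with rfl | rfl | rfl | rfl
            · exact abs_sub_le_of_pos_iff_pos (hsign 0)
            · exact abs_sub_le_of_pos_iff_pos (hsign 1)
            · exact abs_sub_le_of_pos_iff_pos (hsign 2)
            · exact abs_sub_le_of_pos_iff_pos (hsign 3)
          · exact abs_sub_le_of_not_meetsBothSheets hk hv hw
    linarith

/-! ### A branching random walk -/

theorem PMF.mul_toOuterMeasure_le_bind {α β : Type*} (π : PMF α) (κ : α → PMF β) {S : Set α}
    {T : Set β} {c : ℝ≥0∞} (h : ∀ a ∈ S, c ≤ (κ a).toOuterMeasure T) :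
    π.toOuterMeasure S * c ≤ (π.bind κ).toOuterMeasure T := by
  rw [PMF.toOuterMeasure_bind_apply, PMF.toOuterMeasure_apply, ← ENNReal.tsum_mul_right]
  refine ENNReal.tsum_le_tsum fun a => ?_
  by_cases ha : a ∈ S
  · rw [Set.indicator_of_mem ha]
    exact mul_le_mul_right (h a ha) _
  · rw [Set.indicator_of_notMem ha, zero_mul]
    exact zero_le

theorem mul_toOuterMeasure_le_expectDistPow {Ω X : Type*} [MetricSpace X] (π : PMF (Ω × Ω))
    (f : Ω → X) (p : ℝ) {S : Set (Ω × Ω)} {c : ℝ≥0∞}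
    (h : ∀ q ∈ S, c ≤ edist (f q.1) (f q.2) ^ p) :
    π.toOuterMeasure S * c ≤ expectDistPow π f p := by
  rw [PMF.toOuterMeasure_apply, ← ENNReal.tsum_mul_right]
  refine ENNReal.tsum_le_tsum fun a => ?_
  by_cases ha : a ∈ S
  · rw [Set.indicator_of_mem ha]
    exact mul_le_mul_right (h a ha) _
  · rw [Set.indicator_of_notMem ha, zero_mul]
    exact zero_le

theorem expectDistPow_le {Ω X : Type*} [MetricSpace X] (π : PMF (Ω × Ω))
    (f : Ω → X) (p : ℝ) {c : ℝ≥0∞} (h : ∀ q ∈ π.support, edist (f q.1) (f q.2) ^ p ≤ c) :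
    expectDistPow π f p ≤ c := by
  calc expectDistPow π f p ≤ ∑' q, π q * c := by
        refine ENNReal.tsum_le_tsum fun q => ?_
        by_cases hq : q ∈ π.support
        · exact mul_le_mul_right (h q hq) _
        · rw [(π.apply_eq_zero_iff q).2 hq, zero_mul, zero_mul]
    _ = c := by rw [ENNReal.tsum_mul_right, π.tsum_coe, one_mul]

/-- A state of the coin-tossing chain: the current time, and the outcomes of the coins tossed
so far. -/
abbrev CoinState : Type := ℕ × (ℕ → Bool)

/-- Record the outcome `b` of the coin tossed now, and let one unit of time pass. -/
def CoinState.toss (x : CoinState) (b : Bool) : CoinState := (x.1 + 1, Function.update x.2 x.1 b)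

/-- A fair coin. -/
def fairCoin : PMF Bool := PMF.uniformOfFintype Bool

theorem fairCoin_apply (b : Bool) : fairCoin b = 2⁻¹ := by
  simp [fairCoin, PMF.uniformOfFintype_apply]

/-- The transition of the coin-tossing chain: a fair coin is tossed at the times `0, …, N - 1`,
and nothing happens at other times. -/
def coinStep (N : ℕ) (t : ℤ) (x : CoinState) : PMF CoinState :=
  if 0 ≤ t ∧ t < N then fairCoin.map x.toss else PMF.pure x

theorem exists_eq_toss_of_mem_support {N : ℕ} {t : ℤ} (ht : 0 ≤ t ∧ t < N) {x y : CoinState}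
    (hy : y ∈ (coinStep N t x).support) : ∃ b, y = x.toss b := by
  rw [coinStep, if_pos ht, PMF.mem_support_map_iff] at hy
  obtain ⟨b, -, rfl⟩ := hy
  exact ⟨b, rfl⟩

/-- The law at a natural time of the coin-tossing chain. -/
def coinLaw (N : ℕ) : ℕ → PMF CoinState
  | 0 => PMF.pure (0, fun _ => false)
  | n + 1 => (coinLaw N n).bind (coinStep N n)

/-- The coin-tossing chain, which stands still before time `0` and after time `N`. -/
def coinChain (N : ℕ) : MarkovChain CoinState where
  law t := coinLaw N t.toNat
  step := coinStep N
  law_succ t := by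
    rcases lt_or_ge t 0 with ht | ht
    · have h1 : (t + 1).toNat = 0 := by omega
      have h2 : t.toNat = 0 := by omega
      have h3 : coinStep N t = PMF.pure := by
        funext x
        exact if_neg fun h => absurd h.1 (not_le.2 ht)
      rw [h1, h2, h3, PMF.bind_pure]
    · obtain ⟨n, rfl⟩ := Int.eq_ofNat_of_zero_le ht
      rfl

theorem one_le_coinLaw {N n : ℕ} (hn : n ≤ N) :
    1 ≤ (coinLaw N n).toOuterMeasure {x | x.1 = n} := by
  induction n with
  | zero => exact ((PMF.toOuterMeasure_apply_eq_one_iff _ _).2 (by simp [coinLaw])).ge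
  | succ n ih =>
    refine le_trans ?_ (PMF.mul_toOuterMeasure_le_bind (c := 1)
      (S := {x : CoinState | x.1 = n}) _ _ fun x hx => ?_)
    · rw [mul_one]
      exact ih (by omega)
    · refine ((PMF.toOuterMeasure_apply_eq_one_iff _ _).2 fun y hy => ?_).ge
      obtain ⟨b, rfl⟩ := exists_eq_toss_of_mem_support (by omega) hy
      exact congrArg (· + 1) hx

/-- The transition of two chains that evolve independently. -/
def MarkovChain.pairStep {Ω : Type*} (c : MarkovChain Ω) (t : ℤ) (q : Ω × Ω) : PMF (Ω × Ω) :=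
  (c.step t q.1).bind fun x => (c.step t q.2).map fun y => (x, y)

theorem exists_eq_toss_of_mem_support_pairStep {N : ℕ} {t : ℤ} (ht : 0 ≤ t ∧ t < N)
    {q z : CoinState × CoinState} (hz : z ∈ ((coinChain N).pairStep t q).support) :
    ∃ b b', z = (q.1.toss b, q.2.toss b') := by
  rw [MarkovChain.pairStep, PMF.mem_support_bind_iff] at hz
  obtain ⟨x, hx, hz⟩ := hz
  rw [PMF.mem_support_map_iff] at hz
  obtain ⟨y, hy, rfl⟩ := hz
  obtain ⟨b, rfl⟩ := exists_eq_toss_of_mem_support ht hx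
  obtain ⟨b', rfl⟩ := exists_eq_toss_of_mem_support ht hy
  exact ⟨b, b', rfl⟩

theorem one_le_branchedLaw {N s n : ℕ} (h : s + n ≤ N) :
    1 ≤ ((coinChain N).branchedLaw s n).toOuterMeasure {q | q.1.1 = s + n ∧ q.2.1 = s + n} := by
  induction n with
  | zero =>
    refine (one_le_coinLaw (show s ≤ N by omega)).trans ?_
    rw [MarkovChain.branchedLaw, PMF.toOuterMeasure_map_apply]
    refine MeasureTheory.OuterMeasure.mono _ fun x hx => ?_
    exact ⟨hx, hx⟩
  | succ n ih =>
    refine le_trans ?_ (PMF.mul_toOuterMeasure_le_bind (c := 1)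
      (S := {q | q.1.1 = s + n ∧ q.2.1 = s + n}) _ ((coinChain N).pairStep (s + n)) fun q hq => ?_)
    · rw [mul_one]
      exact ih (by omega)
    · refine ((PMF.toOuterMeasure_apply_eq_one_iff _ _).2 fun z hz => ?_).ge
      obtain ⟨b, b', rfl⟩ := exists_eq_toss_of_mem_support_pairStep (by omega) hz
      exact ⟨congrArg (· + 1) hq.1, congrArg (· + 1) hq.2⟩

/-- Two copies of the chain toss different coins at a time after they branched with
probability `1 / 2`. -/
theorem half_le_branchedLaw {N s u n : ℕ} (hsu : s ≤ u) (hun : u < s + n) (h : s + n ≤ N) :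
    2⁻¹ ≤ ((coinChain N).branchedLaw s n).toOuterMeasure
      {q | q.1.1 = s + n ∧ q.2.1 = s + n ∧ q.1.2 u ≠ q.2.2 u} := by
  induction n with
  | zero => omega
  | succ n ih =>
    rcases Nat.lt_or_ge u (s + n) with hlt | hge
    · refine le_trans ?_ (PMF.mul_toOuterMeasure_le_bind (c := 1)
        (S := {q | q.1.1 = s + n ∧ q.2.1 = s + n ∧ q.1.2 u ≠ q.2.2 u}) _
        ((coinChain N).pairStep (s + n)) fun q hq => ?_)
      · rw [mul_one]
        exact ih hlt (by omega)
      · refine ((PMF.toOuterMeasure_apply_eq_one_iff _ _).2 fun z hz => ?_).ge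
        obtain ⟨b, b', rfl⟩ := exists_eq_toss_of_mem_support_pairStep (by omega) hz
        obtain ⟨h1, h2, h3⟩ := hq
        refine ⟨congrArg (· + 1) h1, congrArg (· + 1) h2, ?_⟩
        simpa [CoinState.toss, Function.update_apply, h1, h2, hlt.ne] using h3
    · obtain rfl : u = s + n := by omega
      refine le_trans ?_ (PMF.mul_toOuterMeasure_le_bind (c := 2⁻¹)
        (S := {q | q.1.1 = s + n ∧ q.2.1 = s + n}) _
        ((coinChain N).pairStep (s + n)) fun q hq => ?_)
      · conv_lhs => rw [← one_mul (2⁻¹ : ℝ≥0∞)]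
        exact mul_le_mul_left (one_le_branchedLaw (by omega)) _
      · have hsupp : ((coinChain N).step (s + n) q.1).toOuterMeasure
            ((coinChain N).step (s + n) q.1).support = 1 :=
          (PMF.toOuterMeasure_apply_eq_one_iff _ _).2 subset_rfl
        refine le_trans ?_ (PMF.mul_toOuterMeasure_le_bind (c := 2⁻¹)
          (S := ((coinChain N).step (s + n) q.1).support) _ _ fun x hx => ?_)
        · rw [hsupp, one_mul]
        · have ht : 0 ≤ ((s : ℤ) + n) ∧ ((s : ℤ) + n) < N := by omega
          obtain ⟨b, rfl⟩ := exists_eq_toss_of_mem_support ht hx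
          change _ ≤ ((coinStep N (s + n) q.2).map _).toOuterMeasure _
          rw [coinStep, if_pos ht, PMF.map_comp, PMF.toOuterMeasure_map_apply,
            ← fairCoin_apply (!b), ← PMF.toOuterMeasure_apply_singleton]
          refine MeasureTheory.OuterMeasure.mono _ ?_
          rintro b' rfl
          obtain ⟨h1, h2⟩ := hq
          refine ⟨congrArg (· + 1) h1, congrArg (· + 1) h2, ?_⟩
          simp [CoinState.toss, h1, h2]

/-! ### The walk through the Laakso-type space -/

/-- The beginning of the middle half of the interval of length `4 ^ (k + 2)` that contains `n`. If
`n` lies inside this middle half, it is the time at which the walk, now at height `n`, chose its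
sheet of scale `k`; otherwise its value does not matter, as there is only one sheet. -/
def entryTime (k n : ℕ) : ℕ := 4 ^ (k + 2) * (n / 4 ^ (k + 2)) + 4 ^ (k + 1)

/-- The position of the walk after the coin tosses `x`. It climbs at unit speed and uses the coin
tossed at the entry to a middle half to choose one of the two sheets. -/
def walkPosition (x : CoinState) : laaksoSet :=
  laaksoPoint x.1 fun k => x.2 (entryTime k x.1)

theorem entryTime_of_middleDist_pos {k n : ℕ} (h : 0 < middleDist k n) :
    entryTime k n < n ∧ entryTime k (n + 1) = entryTime k n := by
  have h1 := lt_abs_sub_of_middleDist_pos h (n / 4 ^ (k + 2) : ℕ)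
  have h2 := lt_abs_sub_of_middleDist_pos h (n / 4 ^ (k + 2) + 1 : ℕ)
  have hdiv := Nat.div_add_mod n (4 ^ (k + 2))
  have hmod := Nat.mod_lt n (show 0 < 4 ^ (k + 2) by positivity)
  have hq : 0 < 4 ^ (k + 1) := by positivity
  unfold entryTime
  set P : ℕ := 4 ^ (k + 2) with hP
  set a := n / P
  set b := n % P
  have hPr : (4 : ℝ) ^ (k + 2) = P := by simp [hP]
  have hnr : (n : ℝ) = P * a + b := by exact_mod_cast hdiv.symm
  have hbr : (b : ℝ) < P := by exact_mod_cast hmod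
  rw [hPr, hnr] at h1 h2
  push_cast at h1 h2
  rw [abs_of_nonneg (by ring_nf; positivity)] at h1
  rw [abs_of_nonpos (by linarith)] at h2
  have h1' : 4 ^ (k + 1) < b := by
    have : (4 : ℝ) ^ (k + 1) < b := by linarith
    exact_mod_cast this
  have h2' : 4 ^ (k + 1) + b < P := by
    have : (4 : ℝ) ^ (k + 1) + b < P := by linarith
    exact_mod_cast this
  refine ⟨by omega, ?_⟩
  have : (n + 1) / P = a :=
    Nat.div_eq_of_lt_le (by rw [mul_comm]; omega) (by rw [mul_comm, Nat.mul_succ]; omega)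
  rw [this]

theorem dist_walkPosition_toss_le (x : CoinState) (b : Bool) :
    dist (walkPosition x) (walkPosition (x.toss b)) ≤ 1 := by
  obtain ⟨n, ω⟩ := x
  refine (BoundedContinuousFunction.dist_le (f := (walkPosition (n, ω)).1)
    (g := (walkPosition (CoinState.toss (n, ω) b)).1) zero_le_one).2 ?_
  rintro (_ | k)
  · change |(n : ℝ) - ((n + 1 : ℕ) : ℝ)| ≤ 1
    simp
  · have hlip : |middleDist k n - middleDist k ((n + 1 : ℕ) : ℝ)| ≤ 1 := by
      refine (abs_middleDist_sub_le _ _ _).trans ?_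
      simp
    rw [Real.dist_eq, walkPosition, walkPosition, laaksoPoint_succ, laaksoPoint_succ]
    rcases (middleDist_nonneg k n).lt_or_eq with hpos | hzero
    · obtain ⟨h1, h2⟩ := entryTime_of_middleDist_pos hpos
      simp only [CoinState.toss, h2, Function.update_of_ne h1.ne]
      split_ifs
      · exact hlip
      · rwa [neg_sub_neg, abs_sub_comm]
    · rw [← hzero] at hlip ⊢
      cases (CoinState.toss (n, ω) b).2 (entryTime k (CoinState.toss (n, ω) b).1) <;>
        simpa [CoinState.toss] using hlip

theorem quarter_le_two_mul_middleDist {k j i : ℕ} (hi : i < 4 ^ k) :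
    (4 : ℝ) ^ (k + 1) ≤
      2 * middleDist k ((4 ^ (k + 2) * j + 7 * 4 ^ k + i : ℕ) : ℝ) := by
  have hi' : (i : ℝ) < 4 ^ k := by exact_mod_cast hi
  have h0 : (0 : ℝ) < 4 ^ k := by positivity
  have h1 : (4 : ℝ) ^ (k + 1) = 4 * 4 ^ k := by ring
  have h2 : (4 : ℝ) ^ (k + 2) = 16 * 4 ^ k := by ring
  have hfar : ∀ z : ℤ, 7 * (4 : ℝ) ^ k ≤
      |((4 ^ (k + 2) * j + 7 * 4 ^ k + i : ℕ) : ℝ) - 4 ^ (k + 2) * z| := by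
    intro z
    push_cast
    rw [h2]
    rcases le_or_gt z j with hz | hz
    · have hz' : (z : ℝ) ≤ j := by exact_mod_cast hz
      refine le_trans ?_ (le_abs_self _)
      nlinarith [(Nat.cast_nonneg i : (0 : ℝ) ≤ i)]
    · have hz' : (j : ℝ) + 1 ≤ z := by exact_mod_cast hz
      refine le_trans ?_ (neg_le_abs _)
      nlinarith
  have h3 : 7 * (4 : ℝ) ^ k - 4 ^ (k + 1) ≤
      middleDist k ((4 ^ (k + 2) * j + 7 * 4 ^ k + i : ℕ) : ℝ) :=
    (sub_le_sub_right (hfar _) _).trans (le_max_right _ _)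
  linarith

theorem entryTime_eq {k j i : ℕ} (hi : i < 4 ^ k) :
    entryTime k (4 ^ (k + 2) * j + 7 * 4 ^ k + i) = 4 ^ (k + 2) * j + 4 ^ (k + 1) := by
  have h2 : 4 ^ (k + 2) = 16 * 4 ^ k := by ring
  rw [entryTime, add_assoc, Nat.mul_add_div (by positivity),
    Nat.div_eq_of_lt (show 7 * 4 ^ k + i < 4 ^ (k + 2) by omega), add_zero]

/-- At a time `t` near the middle of a middle half of scale `k`, the copy of the walk that
branched off `4 ^ (k + 1) = 2 ^ (2 * k + 2)` steps before is on the other sheet with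
probability `1 / 2`. -/
theorem half_le_expectDistPow_branchedLaw {N k j i : ℕ} (hi : i < 4 ^ k)
    (hN : 4 ^ (k + 2) * (j + 1) ≤ N) {p : ℝ} (hp : 0 < p) :
    2⁻¹ ≤ expectDistPow ((coinChain N).branchedLaw
      (((4 ^ (k + 2) * j + 7 * 4 ^ k + i : ℕ) : ℤ) - 2 ^ (2 * k + 2)) (2 ^ (2 * k + 2)))
      walkPosition p / (2 : ℝ≥0∞) ^ (((2 * k + 2 : ℕ) : ℝ) * p) := by
  have h1 : 4 ^ (k + 1) = 4 * 4 ^ k := by ring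
  have h2 : 4 ^ (k + 2) = 16 * 4 ^ k := by ring
  have h3 : 2 ^ (2 * k + 2) = 4 * 4 ^ k := by
    rw [show 2 * k + 2 = 2 * (k + 1) by ring, pow_mul, pow_succ]
    ring
  set s : ℕ := 4 ^ (k + 2) * j + 3 * 4 ^ k + i with hs
  have hst : s + 2 ^ (2 * k + 2) = 4 ^ (k + 2) * j + 7 * 4 ^ k + i := by omega
  have hs' : (((4 ^ (k + 2) * j + 7 * 4 ^ k + i : ℕ) : ℤ) - 2 ^ (2 * k + 2)) = (s : ℤ) := by
    rw [← hst]
    push_cast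
    ring
  rw [hs', ENNReal.le_div_iff_mul_le (Or.inl (by simp))
    (Or.inl (by simp [ENNReal.rpow_eq_top_iff]))]
  have hhalf := half_le_branchedLaw (N := N) (s := s) (u := 4 ^ (k + 2) * j + 4 ^ (k + 1))
    (n := 2 ^ (2 * k + 2)) (by omega) (by omega) (by rw [hst]; rw [Nat.mul_succ] at hN; omega)
  refine (mul_le_mul_left hhalf _).trans ?_
  refine mul_toOuterMeasure_le_expectDistPow _ _ _ ?_
  rintro ⟨⟨n, ω⟩, ⟨n', ω'⟩⟩ ⟨hn, hn', hne⟩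
  dsimp only at hn hn' hne
  rw [hst] at hn hn'
  subst hn hn'
  rw [ENNReal.rpow_mul]
  refine ENNReal.rpow_le_rpow ?_ hp.le
  dsimp only
  rw [edist_dist, ENNReal.rpow_natCast,
    show (2 : ℝ≥0∞) ^ (2 * k + 2) = ENNReal.ofReal (4 ^ (k + 1)) by
      rw [show 2 * k + 2 = 2 * (k + 1) by ring, pow_mul, ENNReal.ofReal_pow (by norm_num)]
      norm_num]
  refine ENNReal.ofReal_le_ofReal ?_
  refine le_trans ?_ (abs_sub_le_dist_laaksoSet _ _ (k + 1))
  have hmid := quarter_le_two_mul_middleDist (k := k) (j := j) hi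
  rw [walkPosition, walkPosition, laaksoPoint_succ, laaksoPoint_succ]
  simp only [entryTime_eq hi]
  generalize middleDist k ((4 ^ (k + 2) * j + 7 * 4 ^ k + i : ℕ) : ℝ) = δ at hmid
  generalize ω (4 ^ (k + 2) * j + 4 ^ (k + 1)) = b at hne
  generalize ω' (4 ^ (k + 2) * j + 4 ^ (k + 1)) = b' at hne
  cases b <;> cases b' <;> simp at hne ⊢
  · rw [← abs_neg]
    exact le_trans (by linarith) (le_abs_self _)
  · exact le_trans (by linarith) (le_abs_self _)

/-- Summed over time, each scale `k ≤ M` contributes a fixed proportion of the length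
`4 ^ (M + 2)` of the walk. -/
theorem le_tsum_expectDistPow_branchedLaw {M k : ℕ} (hk : k ≤ M) {p : ℝ} (hp : 0 < p) :
    4 ^ M * 2⁻¹ ≤ ∑' t : ℤ, expectDistPow ((coinChain (4 ^ (M + 2))).branchedLaw
      (t - 2 ^ (2 * k + 2)) (2 ^ (2 * k + 2))) walkPosition p /
        (2 : ℝ≥0∞) ^ (((2 * k + 2 : ℕ) : ℝ) * p) := by
  set F : ℤ → ℝ≥0∞ := fun t => expectDistPow ((coinChain (4 ^ (M + 2))).branchedLaw
      (t - 2 ^ (2 * k + 2)) (2 ^ (2 * k + 2))) walkPosition p /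
        (2 : ℝ≥0∞) ^ (((2 * k + 2 : ℕ) : ℝ) * p)
  let A : Finset (ℕ × ℕ) := Finset.range (4 ^ (M - k)) ×ˢ Finset.range (4 ^ k)
  let g : ℕ × ℕ → ℤ := fun x => ((4 ^ (k + 2) * x.1 + 7 * 4 ^ k + x.2 : ℕ) : ℤ)
  have h16 : 4 ^ (k + 2) = 16 * 4 ^ k := by ring
  have hg : Set.InjOn g A := by
    rintro ⟨j, i⟩ hx ⟨j', i'⟩ hx' h
    simp only [A, Finset.coe_product, Set.mem_prod, Finset.coe_range, Set.mem_Iio] at hx hx'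
    have h1 : 4 ^ (k + 2) * j + i = 4 ^ (k + 2) * j' + i' := by
      have := Int.natCast_inj.1 h
      dsimp only at this
      omega
    have h2 := congrArg (· % 4 ^ (k + 2)) h1
    simp only [Nat.mul_add_mod, Nat.mod_eq_of_lt (show i < 4 ^ (k + 2) by omega),
      Nat.mod_eq_of_lt (show i' < 4 ^ (k + 2) by omega)] at h2
    subst h2
    have h3 : j = j' := Nat.eq_of_mul_eq_mul_left (by positivity) (Nat.add_right_cancel h1)
    rw [h3]
  have hA : A.card = 4 ^ M := by
    rw [Finset.card_product, Finset.card_range, Finset.card_range, ← pow_add,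
      Nat.sub_add_cancel hk]
  have hF : ∀ x ∈ A, 2⁻¹ ≤ F (g x) := by
    rintro ⟨j, i⟩ hx
    simp only [A, Finset.mem_product, Finset.mem_range] at hx
    refine half_le_expectDistPow_branchedLaw hx.2 ?_ hp
    calc 4 ^ (k + 2) * (j + 1) ≤ 4 ^ (k + 2) * 4 ^ (M - k) := Nat.mul_le_mul_left _ hx.1
      _ = 4 ^ (M + 2) := by rw [← pow_add]; congr 1; omega
  calc (4 : ℝ≥0∞) ^ M * 2⁻¹ = ∑ x ∈ A, (2⁻¹ : ℝ≥0∞) := by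
        rw [Finset.sum_const, hA, nsmul_eq_mul]
        norm_num
    _ ≤ ∑ x ∈ A, F (g x) := Finset.sum_le_sum hF
    _ = ∑ t ∈ A.image g, F t := (Finset.sum_image hg).symm
    _ ≤ ∑' t, F t := ENNReal.sum_le_tsum _

theorem tsum_expectDistPow_consecutiveLaw_le (N : ℕ) {p : ℝ} (hp : 0 < p) :
    ∑' t : ℤ, expectDistPow ((coinChain N).consecutiveLaw (t - 1)) walkPosition p ≤ N := by
  have hsupp : ∀ t : ℤ, ∀ q ∈ ((coinChain N).consecutiveLaw (t - 1)).support,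
      q.2 ∈ (coinStep N (t - 1) q.1).support := by
    intro t q hq
    rw [MarkovChain.consecutiveLaw, PMF.mem_support_bind_iff] at hq
    obtain ⟨x, -, hq⟩ := hq
    rw [PMF.mem_support_map_iff] at hq
    obtain ⟨y, hy, rfl⟩ := hq
    exact hy
  rw [tsum_eq_sum (s := Finset.Ioc (0 : ℤ) N)]
  · refine (Finset.sum_le_card_nsmul _ _ 1 fun t ht => ?_).trans_eq (by simp)
    refine expectDistPow_le _ _ _ fun q hq => ?_
    rw [Finset.mem_Ioc] at ht
    obtain ⟨b, hb⟩ := exists_eq_toss_of_mem_support (by omega) (hsupp t q hq)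
    refine ENNReal.rpow_le_one ?_ hp.le
    rw [hb, edist_dist]
    exact ENNReal.ofReal_le_one.2 (dist_walkPosition_toss_le _ _)
  · intro t ht
    rw [Finset.mem_Ioc] at ht
    refine le_antisymm (expectDistPow_le _ _ _ fun q hq => ?_) zero_le
    have h := hsupp t q hq
    rw [coinStep, if_neg (by omega), PMF.mem_support_pure_iff] at h
    rw [h, edist_self, ENNReal.zero_rpow_of_pos hp]

theorem not_isMarkovConvex_laaksoSet {p : ℝ} (hp : 0 < p) : ¬IsMarkovConvex laaksoSet p := by
  rintro ⟨C, hC⟩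
  have hCp : (C : ℝ≥0∞) ^ p ≠ ⊤ := ENNReal.rpow_ne_top_of_nonneg hp.le ENNReal.coe_ne_top
  obtain ⟨M, hM⟩ := ENNReal.exists_nat_gt
    (show (C : ℝ≥0∞) ^ p * 16 * 2 ≠ ⊤ from
      ENNReal.mul_ne_top (ENNReal.mul_ne_top hCp (by simp)) (by simp))
  have hinj : Function.Injective fun k : ℕ => 2 * k + 2 := fun k l h => by
    dsimp only at h
    omega
  have hlow : (M : ℝ≥0∞) * (4 ^ M * 2⁻¹) ≤ (C : ℝ≥0∞) ^ p * 4 ^ (M + 2) := by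
    calc (M : ℝ≥0∞) * (4 ^ M * 2⁻¹) = ∑ k ∈ Finset.range M, ((4 : ℝ≥0∞) ^ M * 2⁻¹) := by simp
      _ ≤ _ := Finset.sum_le_sum fun k hk =>
        le_tsum_expectDistPow_branchedLaw (Finset.mem_range.1 hk).le hp
      _ ≤ _ := ENNReal.sum_le_tsum _
      _ ≤ _ := ENNReal.tsum_comp_le_tsum_of_injective hinj
        fun k : ℕ => ∑' t : ℤ, expectDistPow ((coinChain (4 ^ (M + 2))).branchedLaw
          (t - 2 ^ k) (2 ^ k)) walkPosition p / (2 : ℝ≥0∞) ^ ((k : ℝ) * p)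
      _ ≤ _ := hC CoinState (coinChain (4 ^ (M + 2))) walkPosition
      _ ≤ (C : ℝ≥0∞) ^ p * 4 ^ (M + 2) := by
        refine mul_le_mul_right ?_ _
        exact_mod_cast tsum_expectDistPow_consecutiveLaw_le (4 ^ (M + 2)) hp
  have hlt : (C : ℝ≥0∞) ^ p * 16 * 2 * (4 ^ M * 2⁻¹) < M * (4 ^ M * 2⁻¹) :=
    ENNReal.mul_lt_mul_left (by simp) (ENNReal.mul_ne_top (by simp) (by simp)) hM
  have heq : (C : ℝ≥0∞) ^ p * 16 * 2 * (4 ^ M * 2⁻¹) = (C : ℝ≥0∞) ^ p * 4 ^ (M + 2) := by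
    calc (C : ℝ≥0∞) ^ p * 16 * 2 * (4 ^ M * 2⁻¹)
        = (C : ℝ≥0∞) ^ p * (16 * 4 ^ M) * (2 * 2⁻¹) := by ring
      _ = _ := by
        rw [ENNReal.mul_inv_cancel (by simp) (by simp), mul_one]
        ring
  exact absurd hlow (not_le.2 (heq ▸ hlt))

/-! ### Trees in doubling spaces -/

theorem exists_cover_ball_div_two_pow {X : Type*} [MetricSpace X] {K : ℕ}
    (hK : ∀ (x : X) (r : ℝ), 0 < r → ∃ S : Finset X,
      S.card ≤ K ∧ Metric.ball x r ⊆ ⋃ y ∈ S, Metric.ball y (r / 2))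
    (x : X) {r : ℝ} (hr : 0 < r) (j : ℕ) :
    ∃ S : Finset X, S.card ≤ K ^ j ∧ Metric.ball x r ⊆ ⋃ y ∈ S, Metric.ball y (r / 2 ^ j) := by
  classical
  induction j with
  | zero => exact ⟨{x}, by simp, by simp⟩
  | succ j ih =>
    obtain ⟨S, hS, hcov⟩ := ih
    choose T hT hTcov using fun y : X => hK y (r / 2 ^ j) (by positivity)
    refine ⟨S.biUnion T, ?_, ?_⟩
    · calc (S.biUnion T).card ≤ S.card * K := Finset.card_biUnion_le_card_mul _ _ _ fun y _ => hT y
        _ ≤ K ^ j * K := Nat.mul_le_mul_right _ hS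
        _ = K ^ (j + 1) := (pow_succ _ _).symm
    · intro z hz
      obtain ⟨y, hy, hzy⟩ := Set.mem_iUnion₂.1 (hcov hz)
      obtain ⟨w, hw, hzw⟩ := Set.mem_iUnion₂.1 (hTcov y hzy)
      refine Set.mem_iUnion₂.2 ⟨w, Finset.mem_biUnion.2 ⟨y, hy, hw⟩, ?_⟩
      rwa [pow_succ, ← div_div]

theorem CompleteBinaryTree.one_le_dist {n : ℕ} {u v : CompleteBinaryTree n} (h : u ≠ v) :
    1 ≤ dist u v := by
  have h0 : (binaryTreeGraph n).dist u v ≠ 0 := fun h0 =>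
    h ((binaryTreeGraph_connected n).dist_eq_zero_iff.mp h0)
  have h1 : 1 ≤ (binaryTreeGraph n).dist u v := Nat.one_le_iff_ne_zero.2 h0
  change (1 : ℝ) ≤ ((binaryTreeGraph n).dist u v : ℝ)
  exact_mod_cast h1

/-- The vertex of the tree named by a given word. -/
def CompleteBinaryTree.ofWord {n : ℕ} (l : List Bool) (hl : l.length ≤ n) :
    CompleteBinaryTree n := ⟨l, hl⟩

theorem CompleteBinaryTree.dist_root_le {n : ℕ} (l : List Bool) (hl : l.length ≤ n) :
    dist (ofWord l hl) (ofWord [] (Nat.zero_le n)) ≤ l.length := by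
  induction l with
  | nil => simp
  | cons b l ih =>
    have hl' : l.length ≤ n := by simp at hl; omega
    have hadj : (binaryTreeGraph n).Adj (ofWord (b :: l) hl) (ofWord l hl') := Or.inr ⟨b, rfl⟩
    have h1 : dist (ofWord (b :: l) hl) (ofWord l hl') = 1 := by
      change (((binaryTreeGraph n).dist (ofWord (b :: l) hl) (ofWord l hl') : ℕ) : ℝ) = 1
      rw [SimpleGraph.dist_eq_one_iff_adj.2 hadj, Nat.cast_one]
    have h2 := dist_triangle (ofWord (b :: l) hl) (ofWord l hl') (ofWord [] (Nat.zero_le n))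
    have h3 := ih hl'
    rw [List.length_cons, Nat.cast_succ]
    linarith

/-- Packing bound: the images of the `2 ^ n` leaves are separated, and lie in one ball, so they
cannot be covered by fewer than `2 ^ n` balls of a radius at most half their separation. -/
theorem two_pow_lt_of_embedsWithDistortion {X : Type*} [MetricSpace X] {K : ℕ}
    (hK : ∀ (x : X) (r : ℝ), 0 < r → ∃ S : Finset X,
      S.card ≤ K ∧ Metric.ball x r ⊆ ⋃ y ∈ S, Metric.ball y (r / 2))
    {n j : ℕ} (hn : 0 < n) (hj : K ^ j < 2 ^ n) {D : ℝ} (hD : 0 < D)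
    (h : EmbedsWithDistortion X (CompleteBinaryTree n) D) : (2 : ℝ) ^ j < 4 * D * n := by
  obtain ⟨r, hr, f, hf⟩ := h
  by_contra! hle
  have hn' : (0 : ℝ) < n := by exact_mod_cast hn
  have hR : 0 < 2 * (D * r * n) := by positivity
  have hsmall : 2 * (D * r * n) / 2 ^ j ≤ r / 2 := by
    rw [div_le_iff₀ (by positivity)]
    nlinarith
  let root : CompleteBinaryTree n := .ofWord [] (Nat.zero_le n)
  obtain ⟨S, hS, hcov⟩ :=
    exists_cover_ball_div_two_pow hK (f root) hR j
  let leaf : (Fin n → Bool) → CompleteBinaryTree n := fun b =>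
    .ofWord (List.ofFn b) (by simp)
  have hleaf : Function.Injective leaf := fun b b' hb =>
    List.ofFn_injective (congrArg Subtype.val hb)
  have hmem : ∀ b, ∃ y ∈ S, f (leaf b) ∈ Metric.ball y (2 * (D * r * n) / 2 ^ j) := by
    intro b
    have hball : f (leaf b) ∈ Metric.ball (f root) (2 * (D * r * n)) := by
      have h1 := (hf (leaf b) root).2
      have h2 : dist (leaf b) root ≤ n := by
        have := CompleteBinaryTree.dist_root_le (n := n) (List.ofFn b) (by simp)
        exact this.trans_eq (by rw [List.length_ofFn])
      have h3 : D * r * dist (leaf b) root ≤ D * r * n :=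
        mul_le_mul_of_nonneg_left h2 (by positivity)
      rw [Metric.mem_ball]
      linarith
    simpa using hcov hball
  choose y hyS hy using hmem
  have hinj : Function.Injective y := by
    intro b b' hbb
    by_contra hne
    have h1 := CompleteBinaryTree.one_le_dist (hleaf.ne hne)
    have h2 := (hf (leaf b) (leaf b')).1
    have h3 := dist_triangle_right (f (leaf b)) (f (leaf b')) (y b)
    have h4 := Metric.mem_ball.1 (hy b)
    have h5 := Metric.mem_ball.1 (hy b')
    rw [← hbb] at h5
    nlinarith
  have hcard : 2 ^ n ≤ S.card := by
    have := Finset.card_le_card_of_injOn (s := Finset.univ) y (fun b _ => hyS b) hinj.injOn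
    simpa using this
  omega

/-- Trees have exponentially growing distortion in every doubling space. -/
theorem IsDoublingSpace.exists_rpow_le_distortion {X : Type*} [MetricSpace X]
    (hX : IsDoublingSpace X) :
    ∃ κ : ℝ, 0 < κ ∧
      ∀ᶠ n : ℕ in atTop, (2 : ℝ≥0∞) ^ (κ * (n : ℝ)) ≤ distortion X (CompleteBinaryTree n) := by
  obtain ⟨K, hK⟩ := hX
  set q : ℕ := K + 1 with hq
  have hq0 : (0 : ℝ) < q := by positivity
  have hKq : K ≤ 2 ^ q := (Nat.lt_two_pow_self.trans_le (Nat.pow_le_pow_right two_pos (by omega))).le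
  have hκ : (0 : ℝ) < 1 / (2 * q) := by positivity
  refine ⟨1 / (2 * q), hκ, ?_⟩
  set ρ : ℝ := 2 ^ (1 / (2 * q) : ℝ) with hρ
  have hρ1 : 1 < ρ := Real.one_lt_rpow one_lt_two hκ
  have hlim := tendsto_pow_const_div_const_pow_of_one_lt 1 hρ1
  filter_upwards [hlim.eventually (gt_mem_nhds (show (0 : ℝ) < 1 / 8 by norm_num)),
    eventually_gt_atTop 0] with n hn hn0
  refine le_iInf₂ fun D hD => ?_
  have hn0' : (0 : ℝ) < n := by exact_mod_cast hn0
  set j := (n - 1) / q with hj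
  have hqj : q * j < n := by
    have := Nat.mul_div_le (n - 1) q
    rw [← hj] at this
    omega
  have hKj : K ^ j < 2 ^ n :=
    calc K ^ j ≤ (2 ^ q) ^ j := Nat.pow_le_pow_left hKq j
      _ = 2 ^ (q * j) := (pow_mul _ _ _).symm
      _ < 2 ^ n := Nat.pow_lt_pow_right one_lt_two hqj
  have hDj := two_pow_lt_of_embedsWithDistortion hK hn0 hKj hD.1 hD.2
  -- `n ≤ q * (j + 1)`, and `ρ ^ (2 * q) = 2`, so `ρ ^ (2 * n) ≤ 2 ^ (j + 1)`.
  have hnj : n ≤ q * (j + 1) := by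
    have := Nat.lt_mul_div_succ (n - 1) (show 0 < q by omega)
    rw [← hj] at this
    omega
  have hρq : ρ ^ (2 * q) = 2 := by
    rw [hρ, ← Real.rpow_natCast, ← Real.rpow_mul two_pos.le]
    push_cast
    rw [one_div_mul_cancel (by positivity), Real.rpow_one]
  have hρn : ρ ^ n * ρ ^ n ≤ 2 * 2 ^ j :=
    calc ρ ^ n * ρ ^ n = ρ ^ (2 * n) := by ring
      _ ≤ ρ ^ (2 * q * (j + 1)) := pow_le_pow_right₀ hρ1.le (by nlinarith)
      _ = 2 * 2 ^ j := by rw [pow_mul, hρq]; ring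
  have hρpos : 0 < ρ ^ n := by positivity
  rw [pow_one, div_lt_iff₀ hρpos] at hn
  have hfin : ρ ^ n ≤ D := by
    have h1 : ρ ^ n * ρ ^ n ≤ D * ρ ^ n := by nlinarith [hD.1]
    exact le_of_mul_le_mul_right h1 hρpos
  calc (2 : ℝ≥0∞) ^ (1 / (2 * q) * (n : ℝ)) = ENNReal.ofReal (ρ ^ n) := by
        rw [hρ, ← Real.rpow_natCast, ← Real.rpow_mul two_pos.le,
          ← ENNReal.ofReal_rpow_of_pos two_pos]
        simp
    _ ≤ ENNReal.ofReal D := ENNReal.ofReal_le_ofReal hfin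

theorem tendsto_nhds_top_of_two_rpow_le {u : ℕ → ℝ≥0∞} {κ : ℝ} (hκ : 0 < κ)
    (h : ∀ᶠ n : ℕ in atTop, (2 : ℝ≥0∞) ^ (κ * (n : ℝ)) ≤ u n) : Tendsto u atTop (𝓝 ⊤) := by
  refine tendsto_nhds_top_mono ?_ h
  have h1 : Tendsto (fun n : ℕ => ENNReal.ofReal ((2 : ℝ) ^ (κ * (n : ℝ)))) atTop (𝓝 ⊤) := by
    refine ENNReal.tendsto_ofReal_atTop.comp ?_
    exact (tendsto_rpow_atTop_of_base_gt_one (2 : ℝ) one_lt_two).comp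
      (tendsto_natCast_atTop_atTop.const_mul_atTop hκ)
  refine h1.congr fun n => ?_
  rw [← ENNReal.ofReal_rpow_of_pos two_pos]
  simp

end

theorem theorem1p4 :
    ∃ (X : Type) (_ : MetricSpace X),
      IsDoublingSpace X ∧
      (∀ p : ℝ, 0 < p → ¬ IsMarkovConvex X p) ∧
      Tendsto (fun n : ℕ => distortion X (CompleteBinaryTree n)) atTop (𝓝 ⊤) ∧
      ∃ κ : ℝ, 0 < κ ∧
        ∀ᶠ n : ℕ in atTop, (2 : ℝ≥0∞) ^ (κ * (n : ℝ)) ≤ distortion X (CompleteBinaryTree n) := by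
  obtain ⟨κ, hκ, h⟩ := isDoublingSpace_laaksoSet.exists_rpow_le_distortion
  exact ⟨laaksoSet, inferInstance, isDoublingSpace_laaksoSet,
    fun p hp => not_isMarkovConvex_laaksoSet hp, tendsto_nhds_top_of_two_rpow_le hκ h, κ, hκ, h⟩
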